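/- Consider device-to-device (D2D) communication in the plane $\mathbb{R}^2$ with user density $\lambda>0$, a fraction $\mu\in[0,1]$ of requesting users, and operation mode $\delta\in\{\mathrm{HD},\mathrm{FD}\}$ (half- or full-duplex). Contents $1,\dots,m$ have Zipf popularity $\mathrm{pop}(k)=\bigl(k^{\gamma}\sum_{j=1}^m j^{-\gamma}\bigr)^{-1}$, $\gamma\in\mathbb{R}$. User $i$ caches a set $F_i\subseteq\{1,\dots,m\}$, the sets $F_i$ being pairwise disjoint. Put $f(i)=\sum_{k\in F_i}\mathrm{pop}(k)$, $N=\lceil \mu\lambda\pi R^2\rceil$ for some $R>0$, $f_{\mathrm{hit}}=\sum_{i=1}^N f(i)$, $Q_{\mathrm{FD}}(i)=f_{\mathrm{hit}}-f(i)$, $Q_{\mathrm{HD}}(i)=1-Q_{\mathrm{FD}}(i)$, $\Lambda(i)=\sum_{n=1}^{N-1}\binom{N-1}{n}f(i)^n(1-f(i))^{N-1-n}$. The probability that a user operates in mode $\delta$ is $$\mathcal P_\delta=\sum_{i=1}^N Q_\delta(i)\,\Lambda(i)\,f(i).$$ The transmitters in mode $\delta$ form a homogeneous Poisson point process $\Phi_\delta=\{z_i\}$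 in $\mathbb{R}^2$ of intensity $\mu\mathcal P_\delta\lambda$. The fading gains $h_i$ attached to its points are i.i.d. exponential with mean one and independent of $\Phi_\delta$. All transmitters use power $\rho_d>0$, and the path-loss exponent is $\alpha$. For a fixed location $z_o\in\mathbb{R}^2$ of the serving transmitter, the interference at the receiver at the origin is $$\mathcal I_{d,\delta}=\sum_{z_i\in\Phi_\delta\setminus\{z_o\}}\rho_d\,h_i\,\|z_i\|^{-\alpha},$$ and its Laplace transform is $\mathcal L_{\mathcal I_{d,\delta}}(s)=\mathbb E\bigl[e^{-s\mathcal I_{d,\delta}}\bigr]$. If $\alpha=4$, then $\mathcal I_{d,\delta}$ is almost surely finite, and for every $s\ge 0$ $$\mathcal L_{\mathcal I_{d,\delta}}(s)=\exp\Bigl(-\frac{\pi^2}{2}\,\mu\,\mathcal P_\delta\,\lambda\,\sqrt{s\rho_d}\Bigr).$$ -/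

import Mathlib

open MeasureTheory ProbabilityTheory
open scoped ENNReal NNReal

namespace D2D

noncomputable section

/-! ### Caching model and collaboration probabilities -/

/-- The operation mode of a device-to-device (D2D) transmitter: half-duplex or full-duplex. -/
inductive Mode
  | HD
  | FD

/-- Zipf popularity with skew exponent `γ` of the content of rank `k` in a library of the `m`
contents `1, …, m`. -/
def zipf (γ : ℝ) (m k : ℕ) : ℝ :=
  ((k : ℝ) ^ γ * ∑ j ∈ Finset.Icc 1 m, (j : ℝ) ^ (-γ))⁻¹

/-- Total popularity `f(i)` of the contents cached at user `i`; the cache `F i` is a set of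
ranks. -/
def cachePopularity (γ : ℝ) (m : ℕ) (F : ℕ → Finset ℕ) (i : ℕ) : ℝ :=
  ∑ k ∈ F i, zipf γ m k

/-- Hitting probability: total popularity of the contents cached at the users `1, …, N`. -/
def hitProbability (f : ℕ → ℝ) (N : ℕ) : ℝ :=
  ∑ i ∈ Finset.Icc 1 N, f i

/-- `Λ(i)`: the probability that user `i` can serve at least one of the other `N - 1` users. -/
def serveProbability (f : ℕ → ℝ) (N i : ℕ) : ℝ :=
  ∑ n ∈ Finset.Icc 1 (N - 1), ((N - 1).choose n : ℝ) * f i ^ n * (1 - f i) ^ (N - n - 1)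

/-- `Q_δ(i)`: the probability that the request of user `i` cannot (`HD`), respectively can (`FD`),
be served by another user. -/
def requestProbability (f : ℕ → ℝ) (N : ℕ) : Mode → ℕ → ℝ
  | Mode.HD, i => 1 - (hitProbability f N - f i)
  | Mode.FD, i => hitProbability f N - f i

/-- `P_δ`: the probability that a user operates in mode `δ`. -/
def collaborationProbability (f : ℕ → ℝ) (N : ℕ) (δ : Mode) : ℝ :=
  ∑ i ∈ Finset.Icc 1 N, requestProbability f N δ i * serveProbability f N i * f i

/-- Expected number of requesting users in a disc of radius `R`, rounded up. -/
def numUsers (μ lam R : ℝ) : ℕ :=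
  ⌈μ * lam * Real.pi * R ^ 2⌉₊

/-! ### Point processes in the plane -/

/-- The Euclidean plane. -/
abbrev Plane : Type := EuclideanSpace ℝ (Fin 2)

/-- A point process (random point field) in the plane, given through a measurable enumeration: a random number
`count` (possibly `0` or `∞`) of random points `point 0, point 1, …`; only the points whose index
is smaller than `count` belong to the process. -/
structure PointField (Ω : Type*) [MeasurableSpace Ω] where
  count : Ω → ℕ∞
  point : ℕ → Ω → Plane
  measurable_count : Measurable count
  measurable_point : ∀ i, Measurable (point i)

variable {Ω : Type*} [MeasurableSpace Ω]

/-- The number of points of the process in the set `B`. -/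
def PointField.numPoints (Φ : PointField Ω) (B : Set Plane) (ω : Ω) : ℕ∞ :=
  Set.encard {i : ℕ | (i : ℕ∞) < Φ.count ω ∧ Φ.point i ω ∈ B}

/-- `Φ` is a Poisson point process with intensity measure `ν`: the number of points in a
measurable set `B` with `ν B < ∞` has the Poisson law of mean `ν B`, and the numbers of points in
finitely many disjoint such sets are independent. -/
structure PointField.IsPoisson (Φ : PointField Ω) (ν : Measure Plane) (P : Measure Ω) :
    Prop where
  hasLaw_numPoints : ∀ B : Set Plane, MeasurableSet B → ν B ≠ ∞ →
    HasLaw (Φ.numPoints B)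
      ((poissonMeasure (ν B).toNNReal).map (fun k : ℕ => (k : ℕ∞))) P
  indep_numPoints : ∀ (n : ℕ) (B : Fin n → Set Plane), (∀ j, MeasurableSet (B j)) →
    (∀ j, ν (B j) ≠ ∞) → Pairwise (fun j k => Disjoint (B j) (B k)) →
    iIndepFun (fun j => Φ.numPoints (B j)) P

/-- Homogeneous Poisson point process with `c` points per unit area on average. -/
def PointField.IsHomogeneousPoisson (Φ : PointField Ω) (c : ℝ) (P : Measure Ω) : Prop :=
  Φ.IsPoisson (ENNReal.ofReal c • (volume : Measure Plane)) P

/-! ### Fading, interference, Laplace transform -/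

/-- Independent Rayleigh fading with unit mean: the power gains `h i` attached to the points of
`Φ` are i.i.d. exponential of mean one and independent of the process. -/
structure IsRayleighFading (h : ℕ → Ω → ℝ) (Φ : PointField Ω) (P : Measure Ω) : Prop where
  measurable : ∀ i, Measurable (h i)
  hasLaw : ∀ i, HasLaw (h i) (expMeasure 1) P
  indep : iIndepFun h P
  indep_process :
    IndepFun (fun ω i => h i ω) (fun ω => (Φ.count ω, fun i => Φ.point i ω)) P

/-- The indices of the interferers: all points of the process except the transmitter at `zo`
that serves the receiver of interest. -/
def PointField.interferers (Φ : PointField Ω) (zo : Plane) (ω : Ω) : Set ℕ :=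
  {i : ℕ | (i : ℕ∞) < Φ.count ω ∧ Φ.point i ω ≠ zo}

/-- The power received at the origin from the `i`-th point, with transmit power `ρ` and
path-loss exponent `α`. -/
def receivedPower (Φ : PointField Ω) (h : ℕ → Ω → ℝ) (ρ α : ℝ) (ω : Ω) (i : ℕ) : ℝ :=
  ρ * h i ω * ‖Φ.point i ω‖ ^ (-α)

/-- The interference at the receiver at the origin. -/
def interference (Φ : PointField Ω) (h : ℕ → Ω → ℝ) (ρ α : ℝ) (zo : Plane) (ω : Ω) : ℝ :=
  ∑' i : Φ.interferers zo ω, receivedPower Φ h ρ α ω i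

/-- The Laplace transform `s ↦ 𝔼[exp (-s X)]` of a random variable `X`. -/
def laplaceTransform (X : Ω → ℝ) (P : Measure Ω) (s : ℝ) : ℝ :=
  ∫ ω, Real.exp (-(s * X ω)) ∂P

end

end D2D

/-! For a Poisson process with intensity measure ν and measurable g ≥ 0, E exp(-∑ g(z_i)) = exp(-∫
(1 - e^{-g}) dν) (`PointField.IsPoisson.lintegral_expNeg`): step functions reduce to independent
Poisson counts, and limits give the rest. With the points frozen, integrating out the exponential
gains turns e^{-sI} into ∏ (1 + l(z_i))⁻¹, where l(x) = sρ‖x‖⁻⁴. This is the functional at g = log(1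
+ l), for which 1 - e^{-g} = l/(1 + l) (`lintegral_expNeg_shotNoise`). In the plane with exponent 4
the remaining radial integral is elementary and equals (π²/2)√(sρ).

Everything is computed in [0, ∞] with e^{-∞} = 0, so no convergence has to be known beforehand.
Finiteness follows from the formula: as s ↓ 0, E e^{-sJ} tends to P(J < ∞), while the right-hand
side tends to 1. Excluding the serving transmitter changes nothing, since almost surely no point
lies at z_o. -/

namespace D2D

noncomputable section

/-! ### The exponential e^{-x} on [0, ∞] -/

/-- The function `x ↦ exp (-x)` on `[0, ∞]`, with `exp (-∞) = 0`. -/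
def expNeg (x : ℝ≥0∞) : ℝ≥0∞ := EReal.exp (-(x : EReal))

lemma continuous_expNeg : Continuous expNeg :=
  ENNReal.continuous_exp.comp (continuous_neg.comp continuous_coe_ennreal_ereal)

lemma measurable_expNeg : Measurable expNeg := continuous_expNeg.measurable

lemma antitone_expNeg : Antitone expNeg := fun _ _ hxy =>
  EReal.exp_monotone (EReal.neg_le_neg_iff.2 (EReal.coe_ennreal_le_coe_ennreal_iff.2 hxy))

@[simp] lemma expNeg_zero : expNeg 0 = 1 := by simp [expNeg]

@[simp] lemma expNeg_top : expNeg ∞ = 0 := by simp [expNeg]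

lemma expNeg_le_one (x : ℝ≥0∞) : expNeg x ≤ 1 := by
  simpa using antitone_expNeg zero_le

lemma expNeg_ne_top (x : ℝ≥0∞) : expNeg x ≠ ∞ := ((expNeg_le_one x).trans_lt ENNReal.one_lt_top).ne

lemma expNeg_ofReal {x : ℝ} (hx : 0 ≤ x) :
    expNeg (ENNReal.ofReal x) = ENNReal.ofReal (Real.exp (-x)) := by
  rw [expNeg, EReal.coe_ennreal_ofReal, max_eq_left hx, ← EReal.coe_neg, EReal.exp_coe]

lemma expNeg_add (x y : ℝ≥0∞) : expNeg (x + y) = expNeg x * expNeg y := by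
  rw [expNeg, expNeg, expNeg, ← EReal.exp_add, EReal.coe_ennreal_add,
    EReal.neg_add (by simp) (by simp), sub_eq_add_neg]

lemma expNeg_sum {ι : Type*} (s : Finset ι) (f : ι → ℝ≥0∞) :
    expNeg (∑ i ∈ s, f i) = ∏ i ∈ s, expNeg (f i) := by
  classical
  induction s using Finset.induction_on with
  | empty => simp
  | insert a s ha ih => rw [Finset.sum_insert ha, Finset.prod_insert ha, expNeg_add, ih]

lemma expNeg_mul_natCast (a : ℝ≥0∞) (n : ℕ) : expNeg (a * n) = expNeg a ^ n := by
  simpa [mul_comm] using expNeg_sum (Finset.range n) (fun _ => a)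

/-! ### Laplace functional of a Poisson process -/

/-- Laplace transform of the Poisson distribution. -/
lemma lintegral_expNeg_poissonMeasure (r : ℝ≥0) (a : ℝ≥0∞) :
    ∫⁻ k : ℕ, expNeg (a * k) ∂(poissonMeasure r) = expNeg (r * (1 - expNeg a)) := by
  obtain ⟨q, hq⟩ : ∃ q : ℝ≥0, expNeg a = q := ⟨_, (ENNReal.coe_toNNReal (expNeg_ne_top a)).symm⟩
  have hq1 : q ≤ 1 := by
    have := expNeg_le_one a
    rw [hq] at this
    exact_mod_cast this
  have hterm : ∀ n : ℕ, ENNReal.ofReal (Real.exp (-r) * r ^ n / n.factorial) * expNeg (a * n) =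
      ENNReal.ofReal (Real.exp (-r) * ((r * q : ℝ) ^ n / n.factorial)) := fun n => by
    rw [expNeg_mul_natCast, hq, ← ENNReal.ofReal_coe_nnreal, ← ENNReal.ofReal_pow q.coe_nonneg,
      ← ENNReal.ofReal_mul (by positivity)]
    congr 1
    rw [mul_pow]; ring
  have hsum := (NormedSpace.expSeries_div_hasSum_exp (r * q : ℝ)).mul_left (Real.exp (-r))
  rw [poissonMeasure, lintegral_sum_measure]
  simp_rw [lintegral_smul_measure, lintegral_dirac, smul_eq_mul, hterm]
  rw [← ENNReal.ofReal_tsum_of_nonneg (fun n => by positivity) hsum.summable, hsum.tsum_eq,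
    ← Real.exp_eq_exp_ℝ, ← Real.exp_add, hq]
  have h1 : (r : ℝ≥0∞) * (1 - (q : ℝ≥0∞)) = ENNReal.ofReal (r * (1 - q)) := by
    rw [ENNReal.ofReal_mul r.coe_nonneg, ENNReal.ofReal_coe_nnreal, ENNReal.ofReal_sub _ q.coe_nonneg]
    simp
  rw [h1, expNeg_ofReal (mul_nonneg r.coe_nonneg (sub_nonneg.2 (by exact_mod_cast hq1)))]
  congr 2
  ring

variable {Ω : Type*} [MeasurableSpace Ω]

/-- The counting measure of the points of the process. -/
def PointField.pointMeasure (Φ : PointField Ω) (ω : Ω) : Measure Plane :=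
  ((Measure.count : Measure ℕ).restrict {i | (i : ℕ∞) < Φ.count ω}).map (fun i => Φ.point i ω)

lemma PointField.pointMeasure_apply (Φ : PointField Ω) (ω : Ω) {B : Set Plane}
    (hB : MeasurableSet B) : Φ.pointMeasure ω B = (Φ.numPoints B ω : ℝ≥0∞) := by
  rw [pointMeasure, Measure.map_apply .of_discrete hB, Measure.restrict_apply .of_discrete,
    Measure.count_apply .of_discrete, numPoints]
  congr 2
  ext i
  simp [and_comm]

open Classical in
lemma PointField.lintegral_pointMeasure (Φ : PointField Ω) (ω : Ω) {g : Plane → ℝ≥0∞}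
    (hg : Measurable g) : ∫⁻ x, g x ∂(Φ.pointMeasure ω) =
      ∑' i : ℕ, if (i : ℕ∞) < Φ.count ω then g (Φ.point i ω) else 0 := by
  rw [pointMeasure, lintegral_map hg .of_discrete,
    ← lintegral_indicator (.of_discrete), lintegral_count]
  simp [Set.indicator_apply]

open Classical in
lemma PointField.measurable_lintegral_pointMeasure (Φ : PointField Ω) {g : Plane → ℝ≥0∞}
    (hg : Measurable g) : Measurable (fun ω => ∫⁻ x, g x ∂(Φ.pointMeasure ω)) := by
  simp_rw [Φ.lintegral_pointMeasure _ hg]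
  refine Measurable.tsum fun i => Measurable.ite ?_ (hg.comp (Φ.measurable_point i))
    measurable_const
  exact Φ.measurable_count (.of_discrete : MeasurableSet {n : ℕ∞ | (i : ℕ∞) < n})

lemma PointField.IsPoisson.lintegral_expNeg_mul_numPoints {Φ : PointField Ω} {ν : Measure Plane}
    {P : Measure Ω} (hΦ : Φ.IsPoisson ν P) {B : Set Plane} (hB : MeasurableSet B)
    (hνB : ν B ≠ ∞) (a : ℝ≥0∞) :
    ∫⁻ ω, expNeg (a * Φ.pointMeasure ω B) ∂P = expNeg ((1 - expNeg a) * ν B) := by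
  simp_rw [Φ.pointMeasure_apply _ hB]
  have hm : Measurable (fun k : ℕ∞ => expNeg (a * (k : ℝ≥0∞))) := .of_discrete
  have hlaw := hΦ.hasLaw_numPoints B hB hνB
  rw [← lintegral_map' (μ := P) (g := Φ.numPoints B) hm.aemeasurable hlaw.aemeasurable,
    hlaw.map_eq, lintegral_map hm .of_discrete]
  simp only [ENat.toENNReal_coe]
  rw [lintegral_expNeg_poissonMeasure, ENNReal.coe_toNNReal hνB, mul_comm]

/-- Laplace functional of a Poisson process at a simple function. -/
lemma PointField.IsPoisson.lintegral_expNeg_simpleFunc {Φ : PointField Ω} {ν : Measure Plane}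
    {P : Measure Ω} [IsProbabilityMeasure P] (hΦ : Φ.IsPoisson ν P) (g : SimpleFunc Plane ℝ≥0∞)
    (hg : ∀ y ≠ 0, ν (g ⁻¹' {y}) ≠ ∞) :
    ∫⁻ ω, expNeg (∫⁻ x, g x ∂(Φ.pointMeasure ω)) ∂P =
      expNeg (∫⁻ x, (1 - expNeg (g x)) ∂ν) := by
  classical
  -- The value 0 is dropped: it contributes nothing, and its level set may have infinite measure.
  set s : Finset ℝ≥0∞ := g.range.filter (· ≠ 0) with hs
  let e := s.equivFin.symm
  have hne : ∀ j, (e j : ℝ≥0∞) ≠ 0 := fun j => (Finset.mem_filter.1 (e j).2).2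
  have hsum : ∀ (f : ℝ≥0∞ → ℝ≥0∞) (ρ : Measure Plane), f 0 = 0 →
      ∫⁻ x, f (g x) ∂ρ = ∑ j, f (e j) * ρ (g ⁻¹' {(e j : ℝ≥0∞)}) := fun f ρ hf => by
    have h1 : ∫⁻ x, f (g x) ∂ρ = (g.map f).lintegral ρ := by
      rw [← SimpleFunc.lintegral_eq_lintegral]; simp
    rw [h1, SimpleFunc.map_lintegral, e.sum_comp (fun y : s => f y * ρ (g ⁻¹' {(y : ℝ≥0∞)})),
      Finset.sum_coe_sort s (fun y => f y * ρ (g ⁻¹' {y})), hs, Finset.sum_filter]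
    refine Finset.sum_congr rfl fun y _ => ?_
    by_cases hy : y = 0 <;> simp [hy, hf]
  have hmeas : ∀ j, MeasurableSet (g ⁻¹' {(e j : ℝ≥0∞)}) := fun j => g.measurableSet_preimage _
  have hind := hΦ.indep_numPoints s.card (fun j => g ⁻¹' {(e j : ℝ≥0∞)}) hmeas
    (fun j => hg _ (hne j)) (fun j k hjk => by
      refine Disjoint.preimage _ (Set.disjoint_singleton.2 fun h => hjk ?_)
      exact e.injective (Subtype.ext h))
  have hind' := hind.comp (fun j (k : ℕ∞) => expNeg ((e j : ℝ≥0∞) * (k : ℝ≥0∞)))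
    (fun j => .of_discrete)
  have hcomp : ∀ j, (fun k : ℕ∞ => expNeg ((e j : ℝ≥0∞) * (k : ℝ≥0∞))) ∘
      Φ.numPoints (g ⁻¹' {(e j : ℝ≥0∞)}) =
      fun ω => expNeg ((e j : ℝ≥0∞) * Φ.pointMeasure ω (g ⁻¹' {(e j : ℝ≥0∞)})) := fun j => by
    ext ω
    rw [Φ.pointMeasure_apply _ (hmeas j), Function.comp_apply]
  simp only [hcomp] at hind'
  have hmeas' : ∀ j, Measurable
      (fun ω => expNeg ((e j : ℝ≥0∞) * Φ.pointMeasure ω (g ⁻¹' {(e j : ℝ≥0∞)}))) := fun j => by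
    refine measurable_expNeg.comp (Measurable.const_mul ?_ _)
    simpa [lintegral_indicator_one (hmeas j)] using Φ.measurable_lintegral_pointMeasure
      (g := (g ⁻¹' {(e j : ℝ≥0∞)}).indicator 1) (measurable_one.indicator (hmeas j))
  simp_rw [hsum (fun y => y) _ rfl, hsum (fun y => 1 - expNeg y) ν (by simp), expNeg_sum]
  rw [lintegral_prod_eq_prod_lintegral_of_indepFun Finset.univ _ hind' hmeas']
  exact Finset.prod_congr rfl fun j _ =>
    hΦ.lintegral_expNeg_mul_numPoints (hmeas j) (hg _ (hne j)) _

/-- Laplace functional of a Poisson process. -/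
theorem PointField.IsPoisson.lintegral_expNeg {Φ : PointField Ω} {ν : Measure Plane}
    [IsLocallyFiniteMeasure ν] {P : Measure Ω} [IsProbabilityMeasure P] (hΦ : Φ.IsPoisson ν P)
    {g : Plane → ℝ≥0∞} (hg : Measurable g) :
    ∫⁻ ω, expNeg (∫⁻ x, g x ∂(Φ.pointMeasure ω)) ∂P = expNeg (∫⁻ x, (1 - expNeg (g x)) ∂ν) := by
  let B : ℕ → Set Plane := fun n => Metric.closedBall 0 n
  have hB : ∀ n, MeasurableSet (B n) := fun n => measurableSet_closedBall
  have hBmono : Monotone B := fun m n h => Metric.closedBall_subset_closedBall (by exact_mod_cast h)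
  -- Truncation to balls gives the nonzero level sets finite ν-measure, as the Poisson property
  -- requires, and keeps the approximation increasing.
  let G : ℕ → SimpleFunc Plane ℝ≥0∞ := fun n => (SimpleFunc.eapprox g n).restrict (B n)
  have hG : ∀ n x, G n x = (B n).indicator (SimpleFunc.eapprox g n) x := fun n x => by
    simp [G, SimpleFunc.coe_restrict _ (hB n)]
  have hmono : ∀ x, Monotone fun n => G n x := fun x m n h => by
    simp only [hG]
    exact (Set.indicator_le_indicator_of_subset (hBmono h) (fun _ => zero_le) x).trans
      (Set.indicator_le_indicator (SimpleFunc.monotone_eapprox g h x))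
  have hlim : ∀ x, Filter.Tendsto (fun n => G n x) Filter.atTop (nhds (g x)) := fun x => by
    refine (SimpleFunc.tendsto_eapprox hg x).congr' ?_
    obtain ⟨n, hn⟩ := exists_nat_ge ‖x‖
    filter_upwards [Filter.eventually_ge_atTop n] with k hk
    rw [hG, Set.indicator_of_mem]
    exact hBmono hk (by simpa [B] using hn)
  have hfin : ∀ n, ∀ y ≠ 0, ν (G n ⁻¹' {y}) ≠ ∞ := fun n y hy => by
    refine ((measure_mono fun x hx => ?_).trans_lt
      (isCompact_closedBall (0 : Plane) n).measure_lt_top).ne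
    by_contra h
    refine hy ?_
    rw [← (hx : G n x = y), hG, Set.indicator_of_notMem h]
  have hleft : Filter.Tendsto (fun n => ∫⁻ ω, expNeg (∫⁻ x, G n x ∂(Φ.pointMeasure ω)) ∂P)
      Filter.atTop (nhds (∫⁻ ω, expNeg (∫⁻ x, g x ∂(Φ.pointMeasure ω)) ∂P)) := by
    refine tendsto_lintegral_of_dominated_convergence (fun _ => 1)
      (fun n => measurable_expNeg.comp (Φ.measurable_lintegral_pointMeasure (G n).measurable))
      (fun n => ae_of_all _ fun ω => expNeg_le_one _) (by simp) (ae_of_all _ fun ω => ?_)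
    exact (continuous_expNeg.tendsto _).comp (lintegral_tendsto_of_tendsto_of_monotone
      (fun n => (G n).measurable.aemeasurable) (ae_of_all _ hmono) (ae_of_all _ hlim))
  have hright : Filter.Tendsto (fun n => expNeg (∫⁻ x, (1 - expNeg (G n x)) ∂ν))
      Filter.atTop (nhds (expNeg (∫⁻ x, (1 - expNeg (g x)) ∂ν))) := by
    refine (continuous_expNeg.tendsto _).comp (lintegral_tendsto_of_tendsto_of_monotone
      (fun n => (measurable_const.sub
        (measurable_expNeg.comp (G n).measurable)).aemeasurable) (ae_of_all _ fun x => ?_)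
      (ae_of_all _ fun x => ?_))
    · exact fun m n h => tsub_le_tsub_left (antitone_expNeg (hmono x h)) _
    · exact ENNReal.Tendsto.sub tendsto_const_nhds
        ((continuous_expNeg.tendsto _).comp (hlim x)) (by simp)
  refine tendsto_nhds_unique hleft ?_
  simpa only [hΦ.lintegral_expNeg_simpleFunc _ (hfin _)] using hright

/-! ### Nonnegativity of the mode probability -/

lemma zipf_nonneg (γ : ℝ) (m k : ℕ) : 0 ≤ zipf γ m k := by
  unfold zipf
  positivity

lemma sum_zipf_le_one (γ : ℝ) (m : ℕ) : ∑ k ∈ Finset.Icc 1 m, zipf γ m k ≤ 1 := by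
  simp_rw [zipf, mul_inv, ← Finset.sum_mul, ← Real.rpow_neg (Nat.cast_nonneg _)]
  -- An inequality rather than an equality: for m = 0 the normalising sum is 0, and so is its
  -- inverse.
  exact mul_inv_le_one

lemma cachePopularity_nonneg (γ : ℝ) (m : ℕ) (F : ℕ → Finset ℕ) (i : ℕ) :
    0 ≤ cachePopularity γ m F i :=
  Finset.sum_nonneg fun _ _ => zipf_nonneg _ _ _

lemma sum_cachePopularity_le_one (γ : ℝ) (m : ℕ) {F : ℕ → Finset ℕ}
    (hFm : ∀ i, F i ⊆ Finset.Icc 1 m) (hF : Pairwise (fun i j => Disjoint (F i) (F j)))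
    (s : Finset ℕ) : ∑ i ∈ s, cachePopularity γ m F i ≤ 1 := by
  simp_rw [cachePopularity]
  rw [← Finset.sum_biUnion fun i _ j _ hij => hF hij]
  exact (Finset.sum_le_sum_of_subset_of_nonneg (Finset.biUnion_subset.2 fun i _ => hFm i)
    fun _ _ _ => zipf_nonneg _ _ _).trans (sum_zipf_le_one γ m)

/-- Needed because the intensity enters through `ENNReal.ofReal`, which would replace a negative
value by 0. Disjoint caches keep the total popularity at most 1, which makes the HD factor
nonnegative. -/
lemma collaborationProbability_nonneg {f : ℕ → ℝ} (hf : ∀ i, 0 ≤ f i)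
    (hf1 : ∀ s : Finset ℕ, ∑ i ∈ s, f i ≤ 1) (N : ℕ) (δ : Mode) :
    0 ≤ collaborationProbability f N δ := by
  refine Finset.sum_nonneg fun i hi => mul_nonneg (mul_nonneg ?_ ?_) (hf i)
  · have h1 : f i ≤ hitProbability f N := Finset.single_le_sum (fun j _ => hf j) hi
    have h2 : hitProbability f N ≤ 1 := hf1 _
    cases δ
    · simp only [requestProbability]
      linarith [hf i]
    · exact sub_nonneg.2 h1
  · have h1 : f i ≤ 1 := by simpa using hf1 {i}
    exact Finset.sum_nonneg fun n _ => mul_nonneg (mul_nonneg (Nat.cast_nonneg _)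
      (pow_nonneg (hf i) _)) (pow_nonneg (sub_nonneg.2 h1) _)

/-! ### The exponential law and the radial integral -/

/-- Laplace transform of the exponential distribution of mean one. -/
lemma lintegral_expNeg_expMeasure {w : ℝ} (hw : 0 ≤ w) :
    ∫⁻ x, expNeg (ENNReal.ofReal (w * x)) ∂(expMeasure 1) =
      expNeg (ENNReal.ofReal (Real.log (1 + w))) := by
  have hpos : 0 < 1 + w := by linarith
  have hpdf : ∀ x : ℝ, exponentialPDF 1 x * expNeg (ENNReal.ofReal (w * x)) =
      ENNReal.ofReal (1 + w)⁻¹ * exponentialPDF (1 + w) x := fun x => by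
    rcases lt_or_ge x 0 with hx | hx
    · rw [exponentialPDF_of_neg hx, exponentialPDF_of_neg hx, zero_mul, mul_zero]
    · rw [exponentialPDF_of_nonneg hx, exponentialPDF_of_nonneg hx,
        expNeg_ofReal (mul_nonneg hw hx), ← ENNReal.ofReal_mul (by positivity),
        ← ENNReal.ofReal_mul (by positivity), one_mul, ← Real.exp_add,
        inv_mul_cancel_left₀ hpos.ne']
      congr 2
      ring
  have hm : Measurable (fun x : ℝ => expNeg (ENNReal.ofReal (w * x))) :=
    measurable_expNeg.comp (ENNReal.measurable_ofReal.comp (measurable_const_mul w))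
  have hd : ∀ r : ℝ, Measurable (exponentialPDF r) := fun r =>
    ENNReal.measurable_ofReal.comp (measurable_exponentialPDFReal r)
  have hdens : expMeasure 1 = volume.withDensity (exponentialPDF 1) := rfl
  rw [hdens, lintegral_withDensity_eq_lintegral_mul _ (hd 1) hm]
  simp_rw [Pi.mul_apply, hpdf]
  rw [lintegral_const_mul _ (hd _), lintegral_exponentialPDF_eq_one hpos, mul_one,
    expNeg_ofReal (Real.log_nonneg (by linarith)), Real.exp_neg, Real.exp_log hpos]

/-- `∫ r a / (r⁴ + a) dr` over the half-line, in polar coordinates. -/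
lemma lintegral_plane_div_pow_four_add {a : ℝ} (ha : 0 < a) :
    ∫⁻ x : Plane, ENNReal.ofReal (a / (‖x‖ ^ 4 + a)) =
      ENNReal.ofReal (Real.pi ^ 2 / 2 * √a) := by
  have hsq : √a ^ 2 = a := Real.sq_sqrt ha.le
  have hsa : 0 < √a := Real.sqrt_pos.2 ha
  -- The factor r is the polar Jacobian; substituting u = r² leads to the arctangent.
  have hderiv : ∀ r ∈ Set.Ici (0 : ℝ), HasDerivAt (fun r => √a / 2 * Real.arctan (r ^ 2 / √a))
      (r * (a / (r ^ 4 + a))) r := fun r _ => by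
    have h1 := (((hasDerivAt_pow 2 r).div_const (√a)).arctan).const_mul (√a / 2)
    refine h1.congr_deriv ?_
    generalize √a = b at hsq hsa
    subst hsq
    field_simp
    push_cast
    ring
  have hnonneg : ∀ r ∈ Set.Ioi (0 : ℝ), 0 ≤ r * (a / (r ^ 4 + a)) := fun r hr => by
    have : (0 : ℝ) < r := hr
    positivity
  have hlim : Filter.Tendsto (fun r => √a / 2 * Real.arctan (r ^ 2 / √a)) Filter.atTop
      (nhds (√a / 2 * (Real.pi / 2))) :=
    ((Real.tendsto_arctan_atTop.mono_right nhdsWithin_le_nhds).comp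
      ((Filter.tendsto_pow_atTop two_ne_zero).atTop_div_const hsa)).const_mul _
  have hint := integrableOn_Ioi_deriv_of_nonneg' hderiv hnonneg hlim
  have hval := integral_Ioi_of_hasDerivAt_of_nonneg' hderiv hnonneg hlim
  have hdim : Module.finrank ℝ Plane = 2 := by simp
  have hintegrable : Integrable (fun x : Plane => a / (‖x‖ ^ 4 + a)) := by
    rw [integrable_fun_norm_addHaar volume (f := fun r : ℝ => a / (r ^ 4 + a)), hdim]
    simpa using hint
  rw [← ofReal_integral_eq_lintegral_ofReal hintegrable
    (ae_of_all _ fun x => by positivity),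
    integral_fun_norm_addHaar volume (fun r : ℝ => a / (r ^ 4 + a)), hdim]
  congr 1
  have hball : (volume : Measure Plane).real (Metric.ball 0 1) = Real.pi := by
    simp [measureReal_def, ENNReal.toReal_ofReal Real.pi_pos.le]
  rw [hball]
  simp only [Nat.add_one_sub_one, pow_one, smul_eq_mul, nsmul_eq_mul, hval]
  simp
  ring

/-! ### Shot noise with exponential marks -/

/-- Laplace transform of a weighted series of independent exponential gains. -/
lemma IsRayleighFading.lintegral_expNeg_tsum {h : ℕ → Ω → ℝ} {Φ : PointField Ω} {P : Measure Ω}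
    (hh : IsRayleighFading h Φ P) {w : ℕ → ℝ} (hw : ∀ i, 0 ≤ w i) :
    ∫⁻ ω, expNeg (∑' i, ENNReal.ofReal (w i * h i ω)) ∂P =
      expNeg (∑' i, ENNReal.ofReal (Real.log (1 + w i))) := by
  have := hh.indep.isProbabilityMeasure
  have hm : ∀ i, Measurable (fun x : ℝ => expNeg (ENNReal.ofReal (w i * x))) := fun i =>
    measurable_expNeg.comp (ENNReal.measurable_ofReal.comp (measurable_const_mul (w i)))
  have hmh : ∀ i, Measurable (fun ω => ENNReal.ofReal (w i * h i ω)) := fun i =>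
    ENNReal.measurable_ofReal.comp ((hh.measurable i).const_mul _)
  have hfin : ∀ n, ∫⁻ ω, expNeg (∑ i ∈ Finset.range n, ENNReal.ofReal (w i * h i ω)) ∂P =
      expNeg (∑ i ∈ Finset.range n, ENNReal.ofReal (Real.log (1 + w i))) := fun n => by
    simp_rw [expNeg_sum]
    rw [lintegral_prod_eq_prod_lintegral_of_indepFun _
      (fun i ω => expNeg (ENNReal.ofReal (w i * h i ω))) (hh.indep.comp _ hm)
      (fun i => (hm i).comp (hh.measurable i))]
    refine Finset.prod_congr rfl fun i _ => ?_
    rw [← lintegral_expNeg_expMeasure (hw i), ← (hh.hasLaw i).map_eq,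
      lintegral_map (hm i) (hh.measurable i)]
  refine tendsto_nhds_unique (tendsto_lintegral_of_dominated_convergence (fun _ => 1)
    (fun n => measurable_expNeg.comp (Finset.measurable_sum (Finset.range n) fun i _ => hmh i))
    (fun n => ae_of_all _ fun ω => expNeg_le_one _) (by simp) (ae_of_all _ fun ω =>
      (continuous_expNeg.tendsto _).comp (ENNReal.tendsto_nat_tsum _))) ?_
  exact ((continuous_expNeg.tendsto _).comp (ENNReal.tendsto_nat_tsum _)).congr
    fun n => (hfin n).symm

open Classical in
/-- Laplace transform of the shot noise of a Poisson process with exponential marks. -/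
theorem lintegral_expNeg_shotNoise {P : Measure Ω} [IsProbabilityMeasure P] {Φ : PointField Ω}
    {ν : Measure Plane} [IsLocallyFiniteMeasure ν] (hΦ : Φ.IsPoisson ν P) {h : ℕ → Ω → ℝ}
    (hh : IsRayleighFading h Φ P) {l : Plane → ℝ} (hl : Measurable l) (hl0 : ∀ x, 0 ≤ l x) :
    ∫⁻ ω, expNeg (∑' i : ℕ, if (i : ℕ∞) < Φ.count ω then
      ENNReal.ofReal (l (Φ.point i ω) * h i ω) else 0) ∂P =
      expNeg (∫⁻ x, ENNReal.ofReal (l x / (1 + l x)) ∂ν) := by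
  let H : Ω → ℕ → ℝ := fun ω i => h i ω
  let X : Ω → ℕ∞ × (ℕ → Plane) := fun ω => (Φ.count ω, fun i => Φ.point i ω)
  have hH : Measurable H := measurable_pi_lambda _ hh.measurable
  have hX : Measurable X :=
    Φ.measurable_count.prodMk (measurable_pi_lambda _ Φ.measurable_point)
  let G : (ℕ → ℝ) × (ℕ∞ × (ℕ → Plane)) → ℝ≥0∞ := fun z =>
    expNeg (∑' i : ℕ, if (i : ℕ∞) < z.2.1 then ENNReal.ofReal (l (z.2.2 i) * z.1 i) else 0)
  have hG : Measurable G := by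
    refine measurable_expNeg.comp (Measurable.tsum fun i => Measurable.ite ?_ ?_ measurable_const)
    · exact measurable_snd.fst (.of_discrete : MeasurableSet {n : ℕ∞ | (i : ℕ∞) < n})
    · exact ENNReal.measurable_ofReal.comp ((hl.comp ((measurable_pi_apply i).comp
        measurable_snd.snd)).mul ((measurable_pi_apply i).comp measurable_fst))
  -- Independence makes the joint law a product, so the gains can be integrated with the points
  -- frozen.
  have hfub : ∫⁻ ω, G (H ω, X ω) ∂P = ∫⁻ ω, ∫⁻ ω', G (H ω', X ω) ∂P ∂P := by
    have := Measure.isProbabilityMeasure_map (μ := P) hH.aemeasurable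
    have := Measure.isProbabilityMeasure_map (μ := P) hX.aemeasurable
    rw [← lintegral_map hG (hH.prodMk hX), (indepFun_iff_map_prod_eq_prod_map_map
      hH.aemeasurable hX.aemeasurable).1 hh.indep_process, lintegral_prod_symm' _ hG,
      lintegral_map hG.lintegral_prod_left' hX]
    exact lintegral_congr fun ω =>
      lintegral_map (hG.comp (measurable_id.prodMk measurable_const)) hH
  have hlog : ∀ x, 0 ≤ Real.log (1 + l x) := fun x => Real.log_nonneg (by linarith [hl0 x])
  have hinner : ∀ ω, ∫⁻ ω', G (H ω', X ω) ∂P =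
      expNeg (∫⁻ x, ENNReal.ofReal (Real.log (1 + l x)) ∂(Φ.pointMeasure ω)) := fun ω => by
    rw [Φ.lintegral_pointMeasure ω (by fun_prop)]
    -- Indices beyond the count get weight 0, hence contribute log 1 = 0.
    have h1 := hh.lintegral_expNeg_tsum
      (w := fun i => if (i : ℕ∞) < Φ.count ω then l (Φ.point i ω) else 0)
      (fun i => by split_ifs <;> simp [hl0])
    convert h1 using 4
    · congr 1
      ext i
      split_ifs <;> simp [X, H]
    · split_ifs <;> simp
  refine hfub.trans ?_
  simp_rw [hinner]
  rw [hΦ.lintegral_expNeg (by fun_prop)]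
  congr 2
  ext x
  have hx := hl0 x
  rw [expNeg_ofReal (hlog x), Real.exp_neg, Real.exp_log (by linarith), ← ENNReal.ofReal_one,
    ← ENNReal.ofReal_sub _ (by positivity)]
  congr 1
  field_simp
  ring

/-! ### Null events and path-loss exponent four -/

lemma PointField.IsPoisson.ae_point_ne {P : Measure Ω} {Φ : PointField Ω} {ν : Measure Plane}
    [NullSingletonClass ν] (hΦ : Φ.IsPoisson ν P) (z : Plane) :
    ∀ᵐ ω ∂P, ∀ i : ℕ, (i : ℕ∞) < Φ.count ω → Φ.point i ω ≠ z := by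
  -- A singleton is ν-null, so its count is Poisson of mean 0.
  have hlaw := hΦ.hasLaw_numPoints {z} (measurableSet_singleton z) (by simp)
  have hzero : ∀ᵐ k ∂(poissonMeasure 0), k = 0 := by
    rw [ae_iff, ← Set.compl_ofPred, Set.ofPred_eq_eq_singleton,
      prob_compl_eq_zero_iff (measurableSet_singleton 0), poissonMeasure_singleton]
    simp
  have hae : ∀ᵐ ω ∂P, Φ.numPoints {z} ω = 0 := by
    refine ae_of_ae_map (p := fun k : ℕ∞ => k = 0) hlaw.aemeasurable ?_
    rw [hlaw.map_eq, measure_singleton, ENNReal.toNNReal_zero,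
      ae_map_iff Measurable.of_discrete.aemeasurable .of_discrete]
    simpa using hzero
  filter_upwards [hae] with ω hω i hi hiz
  rw [numPoints, Set.encard_eq_zero] at hω
  exact (Set.ext_iff.1 hω i).1 ⟨hi, hiz⟩

lemma IsRayleighFading.ae_nonneg {h : ℕ → Ω → ℝ} {Φ : PointField Ω} {P : Measure Ω}
    (hh : IsRayleighFading h Φ P) : ∀ᵐ ω ∂P, ∀ i, 0 ≤ h i ω := by
  refine ae_all_iff.2 fun i => ae_of_ae_map (p := fun x : ℝ => 0 ≤ x)
    (hh.measurable i).aemeasurable ?_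
  have hdens : expMeasure 1 = volume.withDensity (exponentialPDF 1) := rfl
  have hmeas : Measurable (exponentialPDF 1) :=
    ENNReal.measurable_ofReal.comp (measurable_exponentialPDFReal 1)
  rw [(hh.hasLaw i).map_eq, hdens, ae_withDensity_iff hmeas]
  refine ae_of_all _ fun x hx => ?_
  by_contra hneg
  exact hx (exponentialPDF_of_neg (not_le.1 hneg))

open Classical in
lemma lintegral_expNeg_smul_interference {P : Measure Ω} [IsProbabilityMeasure P]
    {Φ : PointField Ω} {c : ℝ} (hc : 0 ≤ c) (hΦ : Φ.IsHomogeneousPoisson c P) {h : ℕ → Ω → ℝ}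
    (hh : IsRayleighFading h Φ P) {ρ s : ℝ} (hρ : 0 < ρ) (hs : 0 < s) :
    ∫⁻ ω, expNeg (ENNReal.ofReal s * ∑' i : ℕ, if (i : ℕ∞) < Φ.count ω then
      ENNReal.ofReal (receivedPower Φ h ρ 4 ω i) else 0) ∂P =
      ENNReal.ofReal (Real.exp (-(Real.pi ^ 2 / 2 * c * √(s * ρ)))) := by
  have hsρ : 0 < s * ρ := mul_pos hs hρ
  have : IsLocallyFiniteMeasure (ENNReal.ofReal c • (volume : Measure Plane)) :=
    inferInstanceAs (IsLocallyFiniteMeasure (c.toNNReal • (volume : Measure Plane)))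
  have hmain := lintegral_expNeg_shotNoise hΦ hh (l := fun x => s * ρ * ‖x‖ ^ (-4 : ℝ))
    (by fun_prop) (fun x => by positivity)
  have hrad : ∫⁻ x : Plane, ENNReal.ofReal (s * ρ * ‖x‖ ^ (-4 : ℝ) /
      (1 + s * ρ * ‖x‖ ^ (-4 : ℝ))) = ENNReal.ofReal (Real.pi ^ 2 / 2 * √(s * ρ)) := by
    rw [← lintegral_plane_div_pow_four_add hsρ]
    refine lintegral_congr_ae ?_
    -- At the origin the integrands differ: `0 ^ (-4)` is 0 by convention, so the left one is 0 and
    -- the right one is 1.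
    filter_upwards [Measure.ae_ne volume (0 : Plane)] with x hx
    have hx' : 0 < ‖x‖ := norm_pos_iff.2 hx
    rw [Real.rpow_neg hx'.le, show (4 : ℝ) = (4 : ℕ) by norm_num, Real.rpow_natCast]
    congr 1
    field_simp
  rw [lintegral_smul_measure, hrad, smul_eq_mul, ← ENNReal.ofReal_mul hc,
    expNeg_ofReal (by positivity)] at hmain
  rw [show Real.pi ^ 2 / 2 * c * √(s * ρ) = c * (Real.pi ^ 2 / 2 * √(s * ρ)) by ring, ← hmain]
  refine lintegral_congr fun ω => ?_
  rw [← ENNReal.tsum_mul_left]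
  congr 2
  ext i
  rw [mul_ite, mul_zero, ← ENNReal.ofReal_mul hs.le, receivedPower]
  congr 2
  ring

end

end D2D

/-! ### Finiteness and Laplace transform of the interference -/

theorem corollary1
    {Ω : Type*} [MeasurableSpace Ω] (P : Measure Ω) [IsProbabilityMeasure P]
    -- user density, fraction of requesting users, radius of the region, transmit power
    (lam μ R ρ : ℝ) (hlam : 0 < lam) (hμ : 0 ≤ μ) (hμ1 : μ ≤ 1) (hR : 0 < R) (hρ : 0 < ρ)
    -- library of `m` contents, Zipf exponent, caches without overlap
    (m : ℕ) (γ : ℝ) (F : ℕ → Finset ℕ) (hFm : ∀ i, F i ⊆ Finset.Icc 1 m)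
    (hF : Pairwise (fun i j => Disjoint (F i) (F j)))
    -- operation mode and the probability of that mode
    (δ : D2D.Mode) (Pδ : ℝ)
    (hPδ : Pδ = D2D.collaborationProbability (D2D.cachePopularity γ m F)
      (D2D.numUsers μ lam R) δ)
    -- transmitters in mode `δ`, fading gains, location of the serving transmitter
    (Φ : D2D.PointField Ω) (hΦ : Φ.IsHomogeneousPoisson (μ * Pδ * lam) P)
    (h : ℕ → Ω → ℝ) (hh : D2D.IsRayleighFading h Φ P)
    (zo : D2D.Plane)
    -- path-loss exponent
    (α : ℝ) (hα : α = 4) :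
    (∀ᵐ ω ∂P, Summable (fun i : Φ.interferers zo ω => D2D.receivedPower Φ h ρ α ω i)) ∧
    ∀ s : ℝ, 0 ≤ s →
      D2D.laplaceTransform (D2D.interference Φ h ρ α zo) P s =
        Real.exp (-(Real.pi ^ 2 / 2) * (μ * Pδ * lam) * √(s * ρ)) := by
  classical
  subst hα
  have hPδ0 : 0 ≤ Pδ := hPδ ▸ D2D.collaborationProbability_nonneg
    (D2D.cachePopularity_nonneg γ m F) (D2D.sum_cachePopularity_le_one γ m hFm hF) _ _
  have hc : 0 ≤ μ * Pδ * lam := mul_nonneg (mul_nonneg hμ hPδ0) hlam.le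
  set c := μ * Pδ * lam
  -- The interference as a [0, ∞]-valued sum over all points, including any at `zo`.
  let J : Ω → ℝ≥0∞ := fun ω => ∑' i : ℕ, if (i : ℕ∞) < Φ.count ω then
    ENNReal.ofReal (D2D.receivedPower Φ h ρ 4 ω i) else 0
  have hJ : Measurable J := by
    refine Measurable.tsum fun i => Measurable.ite
      (Φ.measurable_count (.of_discrete : MeasurableSet {n : ℕ∞ | (i : ℕ∞) < n}))
      (ENNReal.measurable_ofReal.comp ?_) measurable_const
    exact ((hh.measurable i).const_mul ρ).mul ((Φ.measurable_point i).norm.pow_const _)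
  have hL : ∀ s, 0 < s → ∫⁻ ω, D2D.expNeg (ENNReal.ofReal s * J ω) ∂P =
      ENNReal.ofReal (Real.exp (-(Real.pi ^ 2 / 2 * c * √(s * ρ)))) := fun s hs =>
    D2D.lintegral_expNeg_smul_interference hc hΦ hh hρ hs
  have hJfin : ∀ᵐ ω ∂P, J ω ≠ ∞ := by
    let t : ℕ → ℝ := fun n => 1 / ((n : ℝ) + 1)
    have ht : ∀ n, 0 < t n := fun n => by positivity
    have ht0 : Filter.Tendsto t Filter.atTop (nhds 0) := tendsto_one_div_add_atTop_nhds_zero_nat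
    have hmeas : MeasurableSet {ω | J ω ≠ ∞} := (hJ (measurableSet_singleton ∞)).compl
    have hl1 : Filter.Tendsto (fun n => ∫⁻ ω, D2D.expNeg (ENNReal.ofReal (t n) * J ω) ∂P)
        Filter.atTop (nhds (∫⁻ ω, {ω | J ω ≠ ∞}.indicator 1 ω ∂P)) := by
      refine tendsto_lintegral_of_dominated_convergence (fun _ => 1)
        (fun n => D2D.measurable_expNeg.comp (hJ.const_mul _))
        (fun n => ae_of_all _ fun ω => D2D.expNeg_le_one _) (by simp) (ae_of_all _ fun ω => ?_)
      by_cases hω : J ω = ∞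
      -- Since `t n > 0`, the product is ∞ for every n, and the exponential stays 0.
      · simp [hω, ENNReal.mul_top, ht]
      · have h1 : Filter.Tendsto (fun n => ENNReal.ofReal (t n) * J ω) Filter.atTop (nhds 0) := by
          simpa using ENNReal.Tendsto.mul_const (ENNReal.tendsto_ofReal ht0) (Or.inr hω)
        simpa [hω, Function.comp_def] using (D2D.continuous_expNeg.tendsto 0).comp h1
    have hl2 : Filter.Tendsto (fun n => ∫⁻ ω, D2D.expNeg (ENNReal.ofReal (t n) * J ω) ∂P)
        Filter.atTop (nhds 1) := by
      simp_rw [hL _ (ht _)]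
      have hcont : Continuous fun s : ℝ =>
          ENNReal.ofReal (Real.exp (-(Real.pi ^ 2 / 2 * c * √(s * ρ)))) :=
        ENNReal.continuous_ofReal.comp (by fun_prop)
      simpa [Function.comp_def] using (hcont.tendsto 0).comp ht0
    have h1 := tendsto_nhds_unique hl1 hl2
    rw [lintegral_indicator_one hmeas] at h1
    exact (prob_compl_eq_zero_iff hmeas).2 h1
  have : NullSingletonClass (ENNReal.ofReal c • (volume : Measure D2D.Plane)) :=
    ⟨fun x => by simp⟩
  have hgood : ∀ᵐ ω ∂P, HasSum (fun i : Φ.interferers zo ω => D2D.receivedPower Φ h ρ 4 ω i)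
      (J ω).toReal := by
    -- Nonnegative gains ensure that `ENNReal.ofReal` loses nothing; the absence of a point at `zo`
    -- makes every point an interferer.
    filter_upwards [hJfin, hh.ae_nonneg, D2D.PointField.IsPoisson.ae_point_ne hΦ zo]
      with ω hω hpos hne
    have h0 : ∀ i, 0 ≤ D2D.receivedPower Φ h ρ 4 ω i := fun i =>
      mul_nonneg (mul_nonneg hρ.le (hpos i)) (by positivity)
    have hset : Φ.interferers zo ω = {i : ℕ | (i : ℕ∞) < Φ.count ω} :=
      Set.ext fun i => ⟨fun hi => hi.1, fun hi => ⟨hi, hne i hi⟩⟩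
    have hsum : HasSum (fun i : ℕ => (if (i : ℕ∞) < Φ.count ω then
        ENNReal.ofReal (D2D.receivedPower Φ h ρ 4 ω i) else 0).toReal) (J ω).toReal := by
      rw [ENNReal.tsum_toReal_eq (ENNReal.ne_top_of_tsum_ne_top hω)]
      exact ENNReal.hasSum_toReal hω
    rw [hset]
    refine (hasSum_subtype_iff_indicator
      (f := fun i : ℕ => D2D.receivedPower Φ h ρ 4 ω i)).2 ?_
    convert hsum using 2 with i
    simp only [Set.indicator_apply, Set.mem_ofPred_eq]
    split_ifs
    · rw [ENNReal.toReal_ofReal (h0 i)]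
    · rfl
  refine ⟨hgood.mono fun ω hω => hω.summable, fun s hs => ?_⟩
  -- The formula `hL` requires s > 0; at s = 0 both sides are 1.
  rcases hs.eq_or_lt with rfl | hs
  · simp [D2D.laplaceTransform]
  have hcongr : ∀ᵐ ω ∂P, Real.exp (-(s * D2D.interference Φ h ρ 4 zo ω)) =
      (D2D.expNeg (ENNReal.ofReal s * J ω)).toReal := by
    filter_upwards [hJfin, hgood] with ω hω hsum
    rw [D2D.interference, hsum.tsum_eq, ← ENNReal.ofReal_toReal hω, ← ENNReal.ofReal_mul hs.le,
      D2D.expNeg_ofReal (by positivity), ENNReal.toReal_ofReal (Real.exp_pos _).le,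
      ENNReal.ofReal_toReal hω]
  have hmeas : Measurable fun ω => D2D.expNeg (ENNReal.ofReal s * J ω) :=
    D2D.measurable_expNeg.comp (hJ.const_mul _)
  rw [D2D.laplaceTransform, integral_congr_ae hcongr, integral_toReal hmeas.aemeasurable
    (ae_of_all _ fun ω => (D2D.expNeg_ne_top _).lt_top), hL s hs,
    ENNReal.toReal_ofReal (Real.exp_pos _).le]
  congr 1
  ring
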